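/- Let $n\ge 1$ be an integer and $p>n$ a real number. Let $\mathcal D^{1,p}(\mathbb R^n)$ be the space of $u\in L^1_{\mathrm{loc}}(\mathbb R^n)$ whose weak partial derivatives all belong to $L^p(\mathbb R^n)$; since $p>n$, each such $u$ is identified with its continuous representative. Write $\|Du\|_p=\left(\int_{\mathbb R^n}|Du|^p\,dx\right)^{1/p}$. Let $\rho$ be a (finite) signed Borel measure on $\mathbb R^n$ with compact support, $\rho(\mathbb R^n)=0$ and $\int_{\mathbb R^n} y\,d\rho(y)\ne 0$. Let $\mathcal S(n)$ be the set of similarity transformations $S(y)=\lambda Oy+z$ with $\lambda>0$, $O\in \mathrm O(n)$, $z\in\mathbb R^n$, and for $u\in\mathcal D^{1,p}(\mathbb R^n)$ put $$ [u]_\rho=\sup\left\{\frac{\left|\int_{\mathbb R^n}u\,d\mu\right|}{\left|\int_{\mathbb R^n}x\,d\mu(x)\right|^{1-n/p}} : \mu=S_\#\rho,\ S\in\mathcal S(n)\right\}. $$ Let $C_*$ be the smallest constant such that $[u]_\rho\le C_*\|Du\|_p$ for all $u\in\mathcal D^{1,p}(\mathbb R^n)$, and call $u\in\mathcal D^{1,p}(\mathbb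 R^n)$ an extremal if $[u]_\rho=C_*\|Du\|_p$. Proposition. Let $S\in\mathcal S(n)$ and $\mu=S_\#\rho$, and let $u$ be an extremal with $$ [u]_\rho=\frac{\left|\int_{\mathbb R^n}u\,d\mu\right|}{\left|\int_{\mathbb R^n}x\,d\mu(x)\right|^{1-n/p}}. $$ Then $u$ is bounded, attains a minimum and a maximum on $\mathrm{supp}(\mu)$, and $$ \inf_{\mathbb R^n}u=\min_{\mathrm{supp}(\mu)}u\qquad\text{and}\qquad \sup_{\mathbb R^n}u=\max_{\mathrm{supp}(\mu)}u . $$ -/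

import Mathlib

open MeasureTheory
open scoped ENNReal ContDiff

namespace MorreyExtremal

/-- `n`-dimensional Euclidean space, with the Euclidean norm. -/
abbrev Rn (n : ℕ) : Type := EuclideanSpace ℝ (Fin n)

/-! ### Weak gradients and the homogeneous Sobolev space -/

/-- `g` is a weak gradient of `u` on the whole space:
`∫ u ∂ᵢφ = - ∫ gᵢ φ` for every smooth compactly supported `φ` and every `i`. -/
def HasWeakGradient {n : ℕ} (u : Rn n → ℝ) (g : Rn n → Rn n) : Prop :=
  LocallyIntegrable u volume ∧ LocallyIntegrable g volume ∧
    ∀ φ : Rn n → ℝ, ContDiff ℝ ∞ φ → HasCompactSupport φ → ∀ i : Fin n,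
      ∫ x, u x * fderiv ℝ φ x (EuclideanSpace.single i 1) = - ∫ x, g x i * φ x

/-- Weak gradients are unique up to null sets. -/
theorem HasWeakGradient.ae_eq {n : ℕ} {u : Rn n → ℝ} {g h : Rn n → Rn n}
    (hg : HasWeakGradient u g) (hh : HasWeakGradient u h) : g =ᵐ[volume] h := by
  have key : ∀ i : Fin n, ∀ᵐ x ∂(volume : Measure (Rn n)), g x i = h x i := by
    intro i
    have comp : ∀ k : Rn n → Rn n, LocallyIntegrable k volume →
        LocallyIntegrable (fun x => k x i) volume := fun k hk x => by
      obtain ⟨s, hs, hks⟩ := hk x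
      exact ⟨s, hs, (EuclideanSpace.proj (𝕜 := ℝ) i).integrable_comp hks⟩
    refine ae_eq_of_integral_contDiff_smul_eq (comp g hg.2.1) (comp h hh.2.1) ?_
    intro φ hφ hφc
    have h1 := hg.2.2 φ hφ hφc i
    have h2 := hh.2.2 φ hφ hφc i
    simp only [smul_eq_mul, mul_comm (φ _)]
    linarith
  filter_upwards [ae_all_iff.2 key] with x hx
  ext i
  exact hx i

open Classical in
/-- The weak gradient `Du` (unique up to null sets), and `0` if there is none. -/
noncomputable def weakGradient {n : ℕ} (u : Rn n → ℝ) : Rn n → Rn n :=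
  if h : ∃ g, HasWeakGradient u g then h.choose else 0

/-- The homogeneous Sobolev space `D^{1,p}(ℝⁿ)` of locally integrable functions whose weak partial
derivatives are in `L^p`. It is used only for `p > n`, where each of its elements has exactly one
continuous representative and is identified with it; so the members are continuous functions. -/
def MemD {n : ℕ} (p : ℝ) (u : Rn n → ℝ) : Prop :=
  Continuous u ∧ (∃ g, HasWeakGradient u g) ∧ MemLp (weakGradient u) (ENNReal.ofReal p) volume

/-- `‖Du‖_p = (∫ |Du|^p)^{1/p}`. -/
noncomputable def gradNorm {n : ℕ} (p : ℝ) (u : Rn n → ℝ) : ℝ≥0∞ :=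
  eLpNorm (weakGradient u) (ENNReal.ofReal p) volume

/-! ### Signed measures and similarities -/

/-- The integral `∫ f dμ` of a scalar or vector function against a signed measure. -/
noncomputable def sintegral {n : ℕ} {F : Type*} [NormedAddCommGroup F] [NormedSpace ℝ F]
    (μ : SignedMeasure (Rn n)) (f : Rn n → F) : F :=
  VectorMeasure.integral μ f (ContinuousLinearMap.lsmul ℝ ℝ).flip

/-- The support of a signed measure: the support of its total variation. -/
noncomputable def ssupport {n : ℕ} (μ : SignedMeasure (Rn n)) : Set (Rn n) :=
  μ.variation.support

/-- The standing assumptions on `ρ`: compact support, total mass zero, nonzero first moment. -/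
structure IsAdmissible {n : ℕ} (ρ : SignedMeasure (Rn n)) : Prop where
  isCompact_support : IsCompact (ssupport ρ)
  mass_eq_zero : ρ Set.univ = 0
  moment_ne_zero : sintegral ρ (fun y => y) ≠ 0

/-- The set of similarity transformations `y ↦ l O y + z` with `l > 0`, `O ∈ O(n)`, `z ∈ ℝⁿ`. -/
def similarities (n : ℕ) : Set (Rn n → Rn n) :=
  {S | ∃ l : ℝ, 0 < l ∧ ∃ (O : Rn n ≃ₗᵢ[ℝ] Rn n) (z : Rn n), ∀ y, S y = l • O y + z}

/-! ### The generalized Morrey inequality -/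

/-- The quotient `|∫ u dμ| / |∫ x dμ|^{1-n/p}`. -/
noncomputable def quotient {n : ℕ} (p : ℝ) (μ : SignedMeasure (Rn n)) (u : Rn n → ℝ) : ℝ :=
  |sintegral μ u| / ‖sintegral μ (fun x => x)‖ ^ (1 - (n : ℝ) / p)

/-- The seminorm `[u]_ρ`, the supremum of the quotients over all `μ = S_# ρ`, `S` a similarity
(as an element of `[0,∞]`). -/
noncomputable def rhoSeminorm {n : ℕ} (p : ℝ) (ρ : SignedMeasure (Rn n)) (u : Rn n → ℝ) : ℝ≥0∞ :=
  ⨆ S ∈ similarities n, ENNReal.ofReal (quotient p (ρ.map S) u)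

/-- The smallest constant `C` with `[u]_ρ ≤ C ‖Du‖_p` for all `u ∈ D^{1,p}(ℝⁿ)`. -/
noncomputable def sharpConst {n : ℕ} (p : ℝ) (ρ : SignedMeasure (Rn n)) : ℝ≥0∞ :=
  sInf {C : ℝ≥0∞ | ∀ u : Rn n → ℝ, MemD p u → rhoSeminorm p ρ u ≤ C * gradNorm p u}

/-- `u ∈ D^{1,p}(ℝⁿ)` is an extremal: equality holds in `[u]_ρ ≤ C_* ‖Du‖_p`. -/
def IsExtremal {n : ℕ} (p : ℝ) (ρ : SignedMeasure (Rn n)) (u : Rn n → ℝ) : Prop :=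
  MemD p u ∧ rhoSeminorm p ρ u = sharpConst p ρ * gradNorm p u

end MorreyExtremal

/-! The proof is by truncation. Let `m` be the minimum of `u` on the compact set supp μ and put `v =
max u m`. Then `v = u` on supp μ, so `u` and `v` have the same quotient at μ, while `Dv` is `Du`
restricted to `{u > m}`. Extremality gives `C_* ‖Du‖ ≤ C_* ‖Dv‖`, and cancelling `C_*` leaves `‖Du‖
≤ ‖Dv‖`. Hence `Du` vanishes a.e. off `{u > m}`, so `Du = Dv` a.e. and `u - v` is constant. The
constant is zero because `u = v` on the nonempty support; thus `u ≥ m` everywhere. The maximum is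
treated in the same way with `min u M`.

The analytic input is the weak gradient of a truncation (`HasWeakGradient.max_const`, from
`HasWeakDeriv.posPart`) and the constancy lemma `eq_of_hasWeakDeriv_zero`, both by mollification.
The variational input is `IsExtremal.eq_of_hasWeakGradient_indicator`. Morrey's inequality itself is
never needed. -/

namespace MorreyExtremal

open Filter Topology Function
open scoped Convolution

variable {n : ℕ}

/-! ### Directional weak derivatives and mollification. -/

/-- `g` is a weak derivative of `u` in the direction `e`. -/
def HasWeakDeriv (u g : Rn n → ℝ) (e : Rn n) : Prop :=
  ∀ φ : Rn n → ℝ, ContDiff ℝ ∞ φ → HasCompactSupport φ →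
    ∫ x, u x * fderiv ℝ φ x e = - ∫ x, g x * φ x

/-- The mollification of `u` by a normalized bump function. -/
noncomputable def mollify (η : ContDiffBump (0 : Rn n)) (u : Rn n → ℝ) : Rn n → ℝ :=
  η.normed volume ⋆[ContinuousLinearMap.lsmul ℝ ℝ, volume] u

theorem mollify_apply (η : ContDiffBump (0 : Rn n)) (u : Rn n → ℝ) (x : Rn n) :
    mollify η u x = ∫ t, u t * η.normed volume (x - t) := by
  simp [mollify, convolution_lsmul_swap, mul_comm]

theorem mollify_eq_convolution_right (η : ContDiffBump (0 : Rn n)) (u : Rn n → ℝ) :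
    mollify η u = u ⋆[ContinuousLinearMap.lsmul ℝ ℝ, volume] η.normed volume := by
  ext x
  simp [mollify_apply, convolution_def]

theorem contDiff_mollify (η : ContDiffBump (0 : Rn n)) {u : Rn n → ℝ}
    (hu : LocallyIntegrable u volume) : ContDiff ℝ ∞ (mollify η u) := by
  rw [mollify_eq_convolution_right]
  exact η.hasCompactSupport_normed.contDiff_convolution_right _ hu η.contDiff_normed

theorem HasWeakDeriv.fderiv_mollify {u g : Rn n → ℝ} {e : Rn n} (h : HasWeakDeriv u g e)
    (hu : LocallyIntegrable u volume) (η : ContDiffBump (0 : Rn n)) (x : Rn n) :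
    fderiv ℝ (mollify η u) x e = mollify η g x := by
  have hd := (η.hasCompactSupport_normed (μ := volume)).hasFDerivAt_convolution_right
    (ContinuousLinearMap.lsmul ℝ ℝ) hu (η.contDiff_normed (n := 1)) x
  have hη : ∀ y, DifferentiableAt ℝ (η.normed volume) y := fun y =>
    (η.contDiff_normed (n := 1)).differentiable (by norm_num) y
  have hcont : Continuous (fderiv ℝ (η.normed volume)) :=
    (η.contDiff_normed (n := 1)).continuous_fderiv (by norm_num)
  rw [mollify_eq_convolution_right, hd.fderiv, convolution_precompR_apply _ hu
    (η.hasCompactSupport_normed.fderiv ℝ) hcont, mollify_apply, convolution_def]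
  -- The test function is the reflected kernel; the sign from the reflection cancels the one from
  -- integration by parts.
  have hφ := h (fun t => η.normed volume (x - t))
    (η.contDiff_normed.comp (contDiff_const.sub contDiff_id))
    (η.hasCompactSupport_normed.comp_homeomorph (Homeomorph.subLeft x))
  have hder : ∀ t, fderiv ℝ (fun t => η.normed volume (x - t)) t e
      = - fderiv ℝ (η.normed volume) (x - t) e := fun t => by
    have hd' : HasFDerivAt (fun t => η.normed volume (x - t)) _ t :=
      (hη (x - t)).hasFDerivAt.comp t ((hasFDerivAt_id t).const_sub x)
    rw [hd'.fderiv]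
    simp
  simp only [hder, mul_neg, integral_neg, neg_inj] at hφ
  simpa using hφ

/-- Mollification is self-adjoint. -/
theorem integral_mollify_mul (η : ContDiffBump (0 : Rn n)) {g ψ : Rn n → ℝ}
    (hg : LocallyIntegrable g volume) (hψ : Continuous ψ) (hψc : HasCompactSupport ψ) :
    ∫ x, mollify η g x * ψ x = ∫ x, g x * mollify η ψ x := by
  have hηc : Continuous (η.normed volume) := (η.contDiff_normed (n := 0)).continuous
  -- The double integrand vanishes unless its second variable lies in the compact set `K`, so `g`
  -- may be cut off to an integrable function and Fubini applies.
  set K : Set (Rn n) := (fun q : Rn n × Rn n => q.1 - q.2) ''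
    (tsupport ψ ×ˢ tsupport (η.normed volume)) with hK
  have hKc : IsCompact K :=
    (IsCompact.prod hψc η.hasCompactSupport_normed).image continuous_sub
  have hgK : Integrable (K.indicator g) volume :=
    (hg.integrableOn_isCompact hKc).integrable_indicator hKc.measurableSet
  have hψi : Integrable ψ volume := hψ.integrable_of_hasCompactSupport hψc
  obtain ⟨C, hC⟩ := η.hasCompactSupport_normed.exists_bound_of_continuous hηc
  have hint : Integrable (fun q : Rn n × Rn n => g q.2 * η.normed volume (q.1 - q.2) * ψ q.1)
      (volume.prod volume) := by
    have h1 := (hψi.mul_prod hgK).bdd_mul (c := C)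
      (f := fun q : Rn n × Rn n => η.normed volume (q.1 - q.2))
      (hηc.comp continuous_sub).aestronglyMeasurable (.of_forall fun q => hC _)
    refine h1.congr (.of_forall fun q => ?_)
    simp only
    by_cases hq : q.2 ∈ K
    · rw [Set.indicator_of_mem hq]; ring
    · have : η.normed volume (q.1 - q.2) = 0 ∨ ψ q.1 = 0 := by
        by_contra! hc
        exact hq ⟨(q.1, q.1 - q.2), ⟨subset_tsupport _ hc.2, subset_tsupport _ hc.1⟩, by simp⟩
      rcases this with h | h <;> simp [h]
  calc ∫ x, mollify η g x * ψ x
      = ∫ x, ∫ t, g t * η.normed volume (x - t) * ψ x := by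
        simp_rw [mollify_apply, integral_mul_const]
    _ = ∫ t, ∫ x, g t * η.normed volume (x - t) * ψ x := integral_integral_swap hint
    _ = ∫ t, g t * mollify η ψ t := by
        refine integral_congr_ae (.of_forall fun t => ?_)
        simp only [mul_assoc]
        rw [integral_const_mul, mollify_apply]
        congr 2
        ext x
        rw [← η.normed_neg, neg_sub, mul_comm]

/-- Bump functions around the origin shrinking to it. -/
noncomputable def shrinkingBump (n k : ℕ) : ContDiffBump (0 : Rn n) where
  rIn := 1 / ((k : ℝ) + 1)
  rOut := 2 * (1 / ((k : ℝ) + 1))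
  rIn_pos := by positivity
  rIn_lt_rOut := lt_mul_of_one_lt_left (by positivity) one_lt_two

theorem tendsto_rOut_shrinkingBump :
    Tendsto (fun k => (shrinkingBump n k).rOut) atTop (𝓝 0) := by
  simpa [shrinkingBump] using (tendsto_one_div_add_atTop_nhds_zero_nat (𝕜 := ℝ)).const_mul 2

/-- Convergence is joint in the index and the point because the chain rule mollifies functions that
themselves depend on the index. -/
theorem tendsto_mollify_prod {u : Rn n → ℝ} (hu : Continuous u) (x : Rn n) :
    Tendsto (fun q : ℕ × Rn n => mollify (shrinkingBump n q.1) u q.2) (atTop ×ˢ 𝓝 x)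
      (𝓝 (u x)) :=
  ContDiffBump.convolution_tendsto_right (tendsto_rOut_shrinkingBump.comp tendsto_fst)
    (.of_forall fun _ => hu.aestronglyMeasurable) ((hu.tendsto x).comp tendsto_snd) tendsto_snd

theorem tendsto_mollify {u : Rn n → ℝ} (hu : Continuous u) (x : Rn n) :
    Tendsto (fun k => mollify (shrinkingBump n k) u x) atTop (𝓝 (u x)) :=
  ContDiffBump.convolution_tendsto_right_of_continuous tendsto_rOut_shrinkingBump hu x

theorem norm_mollify_le (η : ContDiffBump (0 : Rn n)) {u : Rn n → ℝ} {C : ℝ}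
    {x : Rn n} (hC : ∀ y ∈ Metric.ball x η.rOut, |u y| ≤ C) : |mollify η u x| ≤ C := by
  have hηi : Integrable (η.normed volume) (volume : Measure (Rn n)) := η.integrable_normed
  have hi : Integrable (fun t => C * η.normed volume (x - t)) (volume : Measure (Rn n)) :=
    (hηi.comp_sub_left x).const_mul C
  rw [mollify_apply]
  refine (norm_integral_le_of_norm_le (f := fun t => u t * η.normed volume (x - t)) hi
    (.of_forall fun t => ?_)).trans ?_
  · have h0 := η.nonneg_normed (μ := volume) (x - t)
    by_cases ht : t ∈ Metric.ball x η.rOut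
    · rw [norm_mul, Real.norm_of_nonneg h0]
      exact mul_le_mul_of_nonneg_right (hC t ht) h0
    · have : η.normed volume (x - t) = 0 := by
        rw [← notMem_support, η.support_normed_eq]
        simpa [dist_eq_norm, norm_sub_rev] using ht
      simp [this]
  · rw [integral_const_mul, integral_sub_left_eq_self (η.normed volume) volume x,
      η.integral_normed, mul_one]

theorem rOut_shrinkingBump_le (k : ℕ) : (shrinkingBump n k).rOut ≤ 2 := by
  have : 1 / ((k : ℝ) + 1) ≤ 1 := by
    rw [div_le_one (by positivity)]; linarith [(Nat.cast_nonneg k : (0 : ℝ) ≤ k)]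
  change 2 * (1 / ((k : ℝ) + 1)) ≤ 2
  linarith

/-! ### Chain rule, positive part and constancy. -/

/-- Chain rule for weak derivatives of continuous functions. -/
theorem HasWeakDeriv.comp_contDiff {u g : Rn n → ℝ} {e : Rn n} (h : HasWeakDeriv u g e)
    (hu : Continuous u) (hg : LocallyIntegrable g volume) {F : ℝ → ℝ} (hF : ContDiff ℝ 1 F) :
    HasWeakDeriv (fun x => F (u x)) (fun x => deriv F (u x) * g x) e := by
  intro φ hφ hφc
  set v : ℕ → Rn n → ℝ := fun k => mollify (shrinkingBump n k) u with hv
  have hF' : Continuous (deriv F) := hF.continuous_deriv le_rfl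
  have hvs : ∀ k, ContDiff ℝ ∞ (v k) := fun k => contDiff_mollify _ hu.locallyIntegrable
  have hφ' : Continuous (fun x => fderiv ℝ φ x e) :=
    (hφ.continuous_fderiv (by simp)).clm_apply continuous_const
  have hφ'c : HasCompactSupport (fun x => fderiv ℝ φ x e) := hφc.fderiv_apply ℝ e
  -- All mollification radii are at most 2, so on the support of `φ` the mollifications see only
  -- values of `u` on `K`.
  set K := Metric.cthickening 2 (tsupport φ) with hK
  have hKc : IsCompact K := IsCompact.cthickening hφc
  obtain ⟨M, hM⟩ := hKc.exists_bound_of_continuousOn hu.continuousOn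
  obtain ⟨C, hC⟩ := (isCompact_Icc (a := -M) (b := M)).exists_bound_of_continuousOn
    hF.continuous.continuousOn
  obtain ⟨C', hC'0, hC'⟩ : ∃ C', 0 ≤ C' ∧ ∀ s ∈ Set.Icc (-M) M, ‖deriv F s‖ ≤ C' := by
    obtain ⟨C', hC'⟩ := (isCompact_Icc (a := -M) (b := M)).exists_bound_of_continuousOn
      hF'.continuousOn
    exact ⟨max C' 0, le_max_right _ _, fun s hs => (hC' s hs).trans (le_max_left _ _)⟩
  have hvM : ∀ k, ∀ x ∈ tsupport φ, v k x ∈ Set.Icc (-M) M := fun k x hx => by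
    rw [Set.mem_Icc, ← abs_le]
    refine norm_mollify_le _ fun y hy => hM y ?_
    refine Metric.mem_cthickening_of_dist_le y x 2 _ hx ?_
    exact (Metric.mem_ball.1 hy).le.trans (rOut_shrinkingBump_le k)
  -- Classical integration by parts for the smooth `v k`, after which self-adjointness moves the
  -- mollifier from `g` onto a continuous function. The limit then needs only pointwise convergence
  -- and domination by `‖g‖` on `K`.
  have key : ∀ k, ∫ x, F (v k x) * fderiv ℝ φ x e =
      - ∫ x, g x * mollify (shrinkingBump n k) (fun y => deriv F (v k y) * φ y) x := by
    intro k
    have hFv : ∀ x, HasFDerivAt (fun x => F (v k x)) (deriv F (v k x) • fderiv ℝ (v k) x) x :=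
      fun x => (((hF.differentiable (by norm_num)) _).hasDerivAt).comp_hasFDerivAt x
        (((hvs k).differentiable (by simp)) x).hasFDerivAt
    have hvc : Continuous (v k) := (hvs k).continuous
    have hFvc : Continuous (fun x => F (v k x)) := hF.continuous.comp hvc
    have hF'vc : Continuous (fun x => deriv F (v k x)) := hF'.comp hvc
    have hv'c : Continuous (fun x => fderiv ℝ (v k) x e) :=
      ((hvs k).continuous_fderiv (by simp)).clm_apply continuous_const
    have hfd : ∀ x, fderiv ℝ (fun x => F (v k x)) x e = deriv F (v k x) * fderiv ℝ (v k) x e :=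
      fun x => by rw [(hFv x).fderiv]; simp
    rw [integral_mul_fderiv_eq_neg_fderiv_mul_of_integrable]
    · rw [← integral_mollify_mul _ hg (ψ := fun y => deriv F (v k y) * φ y)
        (hF'vc.mul hφ.continuous) hφc.mul_left]
      congr 2
      ext x
      rw [hfd, h.fderiv_mollify hu.locallyIntegrable]
      ring
    · simp only [hfd]
      exact ((hF'vc.mul hv'c).mul hφ.continuous).integrable_of_hasCompactSupport hφc.mul_left
    · exact (hFvc.mul hφ').integrable_of_hasCompactSupport hφ'c.mul_left
    · exact (hFvc.mul hφ.continuous).integrable_of_hasCompactSupport hφc.mul_left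
    · exact fun x _ => (hFv x).differentiableAt
    · exact fun x _ => hφ.differentiable (by simp) x
  have lim1 : Tendsto (fun k => ∫ x, F (v k x) * fderiv ℝ φ x e) atTop
      (𝓝 (∫ x, F (u x) * fderiv ℝ φ x e)) := by
    refine tendsto_integral_of_dominated_convergence (fun x => C * ‖fderiv ℝ φ x e‖) (fun k => ?_)
      ?_ (fun k => .of_forall fun x => ?_) (.of_forall fun x => ?_)
    · exact ((hF.continuous.comp (hvs k).continuous).mul hφ').aestronglyMeasurable
    · exact (hφ'.integrable_of_hasCompactSupport hφ'c).norm.const_mul C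
    · by_cases hx : x ∈ tsupport φ
      · rw [norm_mul]
        exact mul_le_mul_of_nonneg_right (hC _ (hvM k x hx)) (norm_nonneg _)
      · have : fderiv ℝ φ x e = 0 := by
          rw [fderiv_of_notMem_tsupport _ hx]; rfl
        simp [this]
    · exact ((hF.continuous.tendsto _).comp (tendsto_mollify hu x)).mul_const _
  obtain ⟨B, hB⟩ := hφc.exists_bound_of_continuous hφ.continuous
  have hψB : ∀ k y, |deriv F (v k y) * φ y| ≤ C' * B := fun k y => by
    by_cases hy : y ∈ tsupport φ
    · rw [abs_mul]
      exact mul_le_mul (hC' _ (hvM k y hy)) (hB y) (abs_nonneg _) hC'0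
    · rw [image_eq_zero_of_notMem_tsupport hy, mul_zero, abs_zero]
      exact mul_nonneg hC'0 ((norm_nonneg _).trans (hB y))
  have lim2 : Tendsto (fun k => ∫ x, g x * mollify (shrinkingBump n k)
      (fun y => deriv F (v k y) * φ y) x) atTop (𝓝 (∫ x, deriv F (u x) * g x * φ x)) := by
    refine tendsto_integral_of_dominated_convergence
      (fun x => K.indicator (fun x => ‖g x‖ * (C' * B)) x) (fun k => ?_) ?_ (fun k => .of_forall fun x => ?_) (.of_forall fun x => ?_)
    · exact hg.aestronglyMeasurable.mul (contDiff_mollify _ ((hF'.comp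
        (hvs k).continuous).mul hφ.continuous).locallyIntegrable).continuous.aestronglyMeasurable
    · exact (integrable_indicator_iff hKc.measurableSet).2
        ((hg.integrableOn_isCompact hKc).norm.mul_const _)
    · by_cases hx : x ∈ K
      · rw [Set.indicator_of_mem hx, norm_mul]
        exact mul_le_mul_of_nonneg_left (norm_mollify_le _ fun y _ => hψB k y) (norm_nonneg _)
      · rw [Set.indicator_of_notMem hx, norm_mul]
        have h0 : |mollify (shrinkingBump n k) (fun y => deriv F (v k y) * φ y) x| ≤ 0 := by
          refine norm_mollify_le _ fun y hy => ?_
          have : φ y = 0 := by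
            by_contra hne
            refine hx (Metric.mem_cthickening_of_dist_le x y 2 _ (subset_tsupport _ hne) ?_)
            rw [dist_comm]
            exact (Metric.mem_ball.1 hy).le.trans (rOut_shrinkingBump_le k)
          simp [this]
        rw [Real.norm_eq_abs (mollify _ _ _), le_antisymm h0 (abs_nonneg _), mul_zero]
    · have : Tendsto (fun k => mollify (shrinkingBump n k) (fun y => deriv F (v k y) * φ y) x)
          atTop (𝓝 (deriv F (u x) * φ x)) :=
        ContDiffBump.convolution_tendsto_right
          (g := fun k y => deriv F (v k y) * φ y) (k := fun _ => x) tendsto_rOut_shrinkingBump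
          (.of_forall fun k => ((hF'.comp
            (hvs k).continuous).mul hφ.continuous).aestronglyMeasurable)
          (((hF'.tendsto _).comp (tendsto_mollify_prod hu x)).mul
            ((hφ.continuous.tendsto x).comp tendsto_snd)) tendsto_const_nhds
      convert this.const_mul (g x) using 2
      ring
  have := tendsto_nhds_unique (lim1.congr key) lim2.neg
  exact this

/-- The weak derivative of the positive part. -/
theorem HasWeakDeriv.posPart {u g : Rn n → ℝ} {e : Rn n} (h : HasWeakDeriv u g e)
    (hu : Continuous u) (hg : LocallyIntegrable g volume) :
    HasWeakDeriv (fun x => max (u x) 0) ({x | 0 < u x}.indicator g) e := by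
  intro φ hφ hφc
  -- `G` is zero on `s ≤ 0` and the identity on `s ≥ 1`. Its rescalings `F k s = G ((k+1) s) /
  -- (k+1)` tend to the positive part with uniformly bounded derivatives.
  set G : ℝ → ℝ := fun s => s * Real.smoothTransition s with hGdef
  have hG : ContDiff ℝ 1 G := contDiff_id.mul Real.smoothTransition.contDiff
  have hG' : Continuous (deriv G) := hG.continuous_deriv le_rfl
  have hG0 : ∀ s ≤ 0, deriv G s = 0 := by
    have h1 : Set.Iio (0 : ℝ) ⊆ {s | deriv G s = 0} := fun s (hs : s < 0) => by
      have : G =ᶠ[𝓝 s] fun _ => 0 := by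
        filter_upwards [Iio_mem_nhds hs] with t ht
        simp [hGdef, Real.smoothTransition.zero_of_nonpos (le_of_lt ht)]
      simp [this.deriv_eq]
    -- The derivative vanishes at `0` too, so the limiting derivative is exactly the indicator of
    -- `{u > 0}` and the level set `{u = 0}` needs no separate argument.
    have h2 := closure_minimal h1 (isClosed_eq hG' continuous_const)
    rw [closure_Iio] at h2
    exact fun s hs => h2 hs
  have hG1 : ∀ s, 1 < s → deriv G s = 1 := fun s hs => by
    have : G =ᶠ[𝓝 s] fun t => t := by
      filter_upwards [Ioi_mem_nhds hs] with t ht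
      simp [hGdef, Real.smoothTransition.one_of_one_le (le_of_lt ht)]
    simp [this.deriv_eq]
  obtain ⟨C, hC⟩ : ∃ C, ∀ s, ‖deriv G s‖ ≤ C := by
    obtain ⟨C, hC⟩ := (isCompact_Icc (a := (0 : ℝ)) (b := 1)).exists_bound_of_continuousOn
      hG'.continuousOn
    refine ⟨max C 1, fun s => ?_⟩
    rcases le_or_gt s 0 with h0 | h0
    · simp [hG0 s h0]
    rcases le_or_gt s 1 with h1 | h1
    · exact (hC s ⟨h0.le, h1⟩).trans (le_max_left _ _)
    · simp [hG1 s h1]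
  set F : ℕ → ℝ → ℝ := fun k s => s * Real.smoothTransition ((k + 1 : ℝ) * s) with hFdef
  have hFG : ∀ k s, F k s = (k + 1 : ℝ)⁻¹ * G ((k + 1 : ℝ) * s) := fun k s => by
    simp only [hFdef, hGdef]
    field_simp
  have hF : ∀ k, ContDiff ℝ 1 (F k) := fun k => by
    rw [funext (hFG k)]
    exact contDiff_const.mul (hG.comp (contDiff_const.mul contDiff_id))
  have hF' : ∀ k s, deriv (F k) s = deriv G ((k + 1 : ℝ) * s) := fun k s => by
    have h1 : HasDerivAt (fun s => (k + 1 : ℝ)⁻¹ * G ((k + 1 : ℝ) * s))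
        ((k + 1 : ℝ)⁻¹ * (deriv G ((k + 1 : ℝ) * s) * ((k + 1 : ℝ) * 1))) s :=
      (((hG.differentiable (by norm_num) _).hasDerivAt).comp s
        ((hasDerivAt_id s).const_mul _)).const_mul _
    rw [funext (hFG k), h1.deriv]
    field_simp
  have hlarge : ∀ s : ℝ, 0 < s → ∀ᶠ k : ℕ in atTop, 1 < (k + 1 : ℝ) * s := fun s hs => by
    have : Tendsto (fun k : ℕ => ((k : ℝ) + 1) * s) atTop atTop :=
      (tendsto_atTop_add_const_right _ _ tendsto_natCast_atTop_atTop).atTop_mul_const hs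
    exact this.eventually_gt_atTop 1
  have hφ' : Continuous (fun x => fderiv ℝ φ x e) :=
    (hφ.continuous_fderiv (by simp)).clm_apply continuous_const
  have hφ'c : HasCompactSupport (fun x => fderiv ℝ φ x e) := hφc.fderiv_apply ℝ e
  have lim1 : Tendsto (fun k => ∫ x, F k (u x) * fderiv ℝ φ x e) atTop
      (𝓝 (∫ x, max (u x) 0 * fderiv ℝ φ x e)) := by
    refine tendsto_integral_of_dominated_convergence (fun x => ‖u x * fderiv ℝ φ x e‖) (fun k => ?_)
      ?_ (fun k => .of_forall fun x => ?_) (.of_forall fun x => ?_)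
    · exact (((hF k).continuous.comp hu).mul hφ').aestronglyMeasurable
    · exact ((hu.mul hφ').integrable_of_hasCompactSupport hφ'c.mul_left).norm
    · have hb : ‖F k (u x)‖ ≤ ‖u x‖ := by
        simp only [hFdef, norm_mul]
        refine mul_le_of_le_one_right (norm_nonneg (u x)) ?_
        rw [Real.norm_of_nonneg (Real.smoothTransition.nonneg _)]
        exact Real.smoothTransition.le_one _
      simpa only [norm_mul, norm_norm] using
        mul_le_mul_of_nonneg_right hb (norm_nonneg (fderiv ℝ φ x e))
    · refine Tendsto.mul_const _ (tendsto_const_nhds.congr' ?_)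
      rcases le_or_gt (u x) 0 with h0 | h0
      · refine .of_forall fun k => ?_
        rw [max_eq_right h0]
        simp only [hFdef]
        rw [Real.smoothTransition.zero_of_nonpos
          (mul_nonpos_of_nonneg_of_nonpos (by positivity) h0), mul_zero]
      · filter_upwards [hlarge _ h0] with k hk
        rw [max_eq_left h0.le]
        simp only [hFdef]
        rw [Real.smoothTransition.one_of_one_le hk.le, mul_one]
  have hgφ : Integrable (fun x => g x * φ x) volume := by
    simpa [mul_comm] using hg.integrable_smul_left_of_hasCompactSupport hφ.continuous hφc
  have lim2 : Tendsto (fun k => ∫ x, deriv (F k) (u x) * g x * φ x) atTop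
      (𝓝 (∫ x, {x | 0 < u x}.indicator g x * φ x)) := by
    refine tendsto_integral_of_dominated_convergence (fun x => C * ‖g x * φ x‖) (fun k => ?_)
      (hgφ.norm.const_mul C) (fun k => .of_forall fun x => ?_) (.of_forall fun x => ?_)
    · exact ((((hF k).continuous_deriv le_rfl).comp hu).aestronglyMeasurable.mul
        hg.aestronglyMeasurable).mul hφ.continuous.aestronglyMeasurable
    · rw [mul_assoc, norm_mul, hF']
      exact mul_le_mul_of_nonneg_right (hC _) (norm_nonneg _)
    · refine Tendsto.mul_const _ (tendsto_const_nhds.congr' ?_)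
      rcases le_or_gt (u x) 0 with h0 | h0
      · refine .of_forall fun k => ?_
        simp only
        rw [hF', hG0 _ (mul_nonpos_of_nonneg_of_nonpos (by positivity) h0), zero_mul,
          Set.indicator_of_notMem (by simpa using h0)]
      · filter_upwards [hlarge _ h0] with k hk
        rw [hF', hG1 _ hk, one_mul, Set.indicator_of_mem (by exact h0)]
  exact tendsto_nhds_unique (lim1.congr fun k => h.comp_contDiff hu hg (hF k) φ hφ hφc) lim2.neg

/-- A continuous function all of whose weak derivatives vanish is constant. -/
theorem eq_of_hasWeakDeriv_zero {u : Rn n → ℝ} (hu : Continuous u)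
    (h : ∀ i : Fin n, HasWeakDeriv u (fun _ => 0) (EuclideanSpace.single i 1)) (x y : Rn n) :
    u x = u y := by
  -- Each mollification is smooth with zero derivative, hence constant; letting the bumps shrink
  -- recovers `u`.
  have hk : ∀ η : ContDiffBump (0 : Rn n), mollify η u x = mollify η u y := fun η => by
    refine is_const_of_fderiv_eq_zero
      ((contDiff_mollify η hu.locallyIntegrable).differentiable (by simp)) (fun z => ?_) x y
    refine ContinuousLinearMap.coe_injective
      ((EuclideanSpace.basisFun (Fin n) ℝ).toBasis.ext fun i => ?_)
    simp [(h i).fderiv_mollify hu.locallyIntegrable η z, mollify_apply]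
  exact tendsto_nhds_unique (tendsto_mollify hu x)
    ((tendsto_mollify hu y).congr fun k => (hk _).symm)

/-! ### Linear operations on weak derivatives and passage to weak gradients. -/

namespace HasWeakDeriv

variable {u v g h : Rn n → ℝ} {e : Rn n}

theorem congr_ae (hu : HasWeakDeriv u g e) (hgh : g =ᵐ[volume] h) : HasWeakDeriv u h e := by
  intro φ hφ hφc
  rw [hu φ hφ hφc]
  congr 1
  exact integral_congr_ae (hgh.mono fun x hx => by simp only [hx])

theorem neg (hu : HasWeakDeriv u g e) : HasWeakDeriv (fun x => -u x) (fun x => -g x) e := by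
  intro φ hφ hφc
  simp only [neg_mul, integral_neg, hu φ hφ hφc]

theorem add (hu : HasWeakDeriv u g e) (hv : HasWeakDeriv v h e) (huc : Continuous u)
    (hvc : Continuous v) (hg : LocallyIntegrable g volume) (hh : LocallyIntegrable h volume) :
    HasWeakDeriv (fun x => u x + v x) (fun x => g x + h x) e := by
  intro φ hφ hφc
  have hφ' : Continuous (fun x => fderiv ℝ φ x e) :=
    (hφ.continuous_fderiv (by simp)).clm_apply continuous_const
  have hφ'c : HasCompactSupport (fun x => fderiv ℝ φ x e) := hφc.fderiv_apply ℝ e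
  have hint : ∀ {k : Rn n → ℝ}, LocallyIntegrable k volume →
      Integrable (fun x => k x * φ x) volume := fun hk => by
    simpa [mul_comm] using hk.integrable_smul_left_of_hasCompactSupport hφ.continuous hφc
  simp only [add_mul]
  rw [integral_add (f := fun x => u x * fderiv ℝ φ x e) (g := fun x => v x * fderiv ℝ φ x e)
    ((huc.mul hφ').integrable_of_hasCompactSupport hφ'c.mul_left)
    ((hvc.mul hφ').integrable_of_hasCompactSupport hφ'c.mul_left),
    integral_add (hint hg) (hint hh), hu φ hφ hφc, hv φ hφ hφc]
  ring

end HasWeakDeriv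

theorem hasWeakDeriv_of_contDiff {w : Rn n → ℝ} (hw : ContDiff ℝ 1 w) (e : Rn n) :
    HasWeakDeriv w (fun x => fderiv ℝ w x e) e := by
  intro φ hφ hφc
  have hφ' : Continuous (fun x => fderiv ℝ φ x e) :=
    (hφ.continuous_fderiv (by simp)).clm_apply continuous_const
  have hw' : Continuous (fun x => fderiv ℝ w x e) :=
    (hw.continuous_fderiv one_ne_zero).clm_apply continuous_const
  refine integral_mul_fderiv_eq_neg_fderiv_mul_of_integrable ?_ ?_ ?_
    (fun x _ => hw.differentiable (by norm_num) x) (fun x _ => hφ.differentiable (by simp) x)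
  · exact (hw'.mul hφ.continuous).integrable_of_hasCompactSupport hφc.mul_left
  · exact (hw.continuous.mul hφ').integrable_of_hasCompactSupport
      (hφc.fderiv_apply ℝ e).mul_left
  · exact (hw.continuous.mul hφ.continuous).integrable_of_hasCompactSupport hφc.mul_left

theorem HasWeakDeriv.add_const {u g : Rn n → ℝ} {e : Rn n} (h : HasWeakDeriv u g e)
    (hu : Continuous u) (hg : LocallyIntegrable g volume) (c : ℝ) :
    HasWeakDeriv (fun x => u x + c) g e := by
  have hc := hasWeakDeriv_of_contDiff (n := n) (contDiff_const (c := c)) e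
  simp only [fderiv_fun_const, Pi.zero_apply, zero_apply] at hc
  simpa using h.add hc hu continuous_const hg locallyIntegrable_zero

theorem locallyIntegrable_coord {g : Rn n → Rn n} (hg : LocallyIntegrable g volume) (i : Fin n) :
    LocallyIntegrable (fun x => g x i) volume := fun x => by
  obtain ⟨s, hs, hks⟩ := hg x
  exact ⟨s, hs, (EuclideanSpace.proj (𝕜 := ℝ) i).integrable_comp hks⟩

theorem hasWeakGradient_weakGradient {u : Rn n → ℝ} (h : ∃ g, HasWeakGradient u g) :
    HasWeakGradient u (weakGradient u) := by
  rw [weakGradient, dif_pos h]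
  exact h.choose_spec

theorem HasWeakGradient.weakGradient_ae_eq {u : Rn n → ℝ} {g : Rn n → Rn n}
    (h : HasWeakGradient u g) : weakGradient u =ᵐ[volume] g :=
  (hasWeakGradient_weakGradient ⟨g, h⟩).ae_eq h

theorem HasWeakGradient.memD {u : Rn n → ℝ} {g : Rn n → Rn n} {p : ℝ}
    (h : HasWeakGradient u g) (hu : Continuous u) (hg : MemLp g (ENNReal.ofReal p) volume) :
    MemD p u :=
  ⟨hu, ⟨g, h⟩, hg.ae_eq h.weakGradient_ae_eq.symm⟩

theorem HasWeakGradient.gradNorm_eq {u : Rn n → ℝ} {g : Rn n → Rn n}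
    (h : HasWeakGradient u g) (p : ℝ) :
    gradNorm p u = eLpNorm g (ENNReal.ofReal p) volume :=
  eLpNorm_congr_ae h.weakGradient_ae_eq

/-! ### Truncations, equality of gradients, and rigidity of the `L^p` norm. -/

/-- Truncation from below of a continuous function with a weak gradient. -/
theorem HasWeakGradient.max_const {u : Rn n → ℝ} {g : Rn n → Rn n}
    (h : HasWeakGradient u g) (hu : Continuous u) (m : ℝ) :
    HasWeakGradient (fun x => max (u x) m) ({x | m < u x}.indicator g) := by
  have hA : MeasurableSet {x | m < u x} := (isOpen_lt continuous_const hu).measurableSet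
  refine ⟨(hu.max continuous_const).locallyIntegrable, h.2.1.indicator hA, ?_⟩
  suffices H : ∀ i, HasWeakDeriv (fun x => max (u x) m)
      (fun x => {x | m < u x}.indicator g x i) (EuclideanSpace.single i 1) from
    fun φ hφ hφc i => H i φ hφ hφc
  intro i
  have hi : HasWeakDeriv u (fun x => g x i) (EuclideanSpace.single i 1) :=
    fun φ hφ hφc => h.2.2 φ hφ hφc i
  have hgi := locallyIntegrable_coord h.2.1 i
  -- Uses `max u m = max (u - m) 0 + m`.
  have h1 := (hi.add_const hu hgi (-m)).posPart (hu.add continuous_const) hgi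
  have hA' : {x | 0 < u x + -m} = {x | m < u x} := by
    ext x; simp only [Set.mem_ofPred_eq]; constructor <;> intro <;> linarith
  rw [hA'] at h1
  have h2 := h1.add_const ((hu.add continuous_const).max continuous_const) (hgi.indicator hA) m
  convert h2 using 2 with x x
  · rw [← max_add_add_right]; simp
  · by_cases hx : x ∈ {x | m < u x} <;> simp [hx]

theorem HasWeakGradient.neg {u : Rn n → ℝ} {g : Rn n → Rn n} (h : HasWeakGradient u g) :
    HasWeakGradient (fun x => -u x) (fun x => -g x) :=
  ⟨h.1.neg, h.2.1.neg, fun φ hφ hφc i => by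
    have := HasWeakDeriv.neg (fun φ hφ hφc => h.2.2 φ hφ hφc i) φ hφ hφc
    simpa using this⟩

/-- Truncation from above of a continuous function with a weak gradient. -/
theorem HasWeakGradient.min_const {u : Rn n → ℝ} {g : Rn n → Rn n}
    (h : HasWeakGradient u g) (hu : Continuous u) (M : ℝ) :
    HasWeakGradient (fun x => min (u x) M) ({x | u x < M}.indicator g) := by
  have h1 := (h.neg.max_const hu.neg (-M)).neg
  convert h1 using 2 with x x
  · rw [max_neg_neg, neg_neg]
  · by_cases hx : x ∈ {x | u x < M} <;> simp_all

/-- Continuous functions with the same weak gradient differ by a constant. -/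
theorem HasWeakGradient.sub_eq {u v : Rn n → ℝ} {g h : Rn n → Rn n} (hu : HasWeakGradient u g)
    (hv : HasWeakGradient v h) (huc : Continuous u) (hvc : Continuous v)
    (hgh : g =ᵐ[volume] h) (x y : Rn n) : u x - v x = u y - v y := by
  refine eq_of_hasWeakDeriv_zero (u := fun x => u x - v x) (huc.sub hvc) (fun i => ?_) x y
  have h1 : HasWeakDeriv u (fun x => g x i) (EuclideanSpace.single i 1) :=
    fun φ hφ hφc => hu.2.2 φ hφ hφc i
  have h2 : HasWeakDeriv v (fun x => h x i) (EuclideanSpace.single i 1) :=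
    fun φ hφ hφc => hv.2.2 φ hφ hφc i
  have h3 := h1.add h2.neg huc hvc.neg (locallyIntegrable_coord hu.2.1 i)
    (locallyIntegrable_coord hv.2.1 i).neg
  simp only [← sub_eq_add_neg] at h3
  refine h3.congr_ae (hgh.mono fun x hx => ?_)
  simp only [hx, sub_self]

/-- Smooth compactly supported functions belong to `D^{1,p}`. -/
theorem memD_of_contDiff {w : Rn n → ℝ} (hw : ContDiff ℝ 1 w) (hwc : HasCompactSupport w)
    (p : ℝ) : MemD p w := by
  set g : Rn n → Rn n := fun x =>
    WithLp.toLp 2 (fun i => fderiv ℝ w x (EuclideanSpace.single i 1)) with hg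
  have hgc : Continuous g := (PiLp.continuous_toLp 2 _).comp <| continuous_pi fun i =>
    (hw.continuous_fderiv one_ne_zero).clm_apply continuous_const
  have hgs : HasCompactSupport g := (hwc.fderiv ℝ).mono' <| by
    refine (fun x hx => subset_tsupport _ fun h0 => hx ?_)
    simp only [hg, h0]
    rfl
  refine HasWeakGradient.memD (g := g) ⟨hw.continuous.locallyIntegrable, hgc.locallyIntegrable,
    fun φ hφ hφc i => hasWeakDeriv_of_contDiff hw _ φ hφ hφc⟩ hw.continuous
    (hgc.memLp_of_hasCompactSupport hgs)

/-- If restricting a function to a set does not decrease its `L^p` norm, the function vanishes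
off that set. -/
theorem indicator_ae_eq_of_eLpNorm_le {g : Rn n → Rn n} {q : ℝ≥0∞} (hq0 : q ≠ 0) (hq : q ≠ ⊤)
    {A : Set (Rn n)} (hA : MeasurableSet A) (hg : MemLp g q volume)
    (h : eLpNorm g q volume ≤ eLpNorm (A.indicator g) q volume) :
    g =ᵐ[volume] A.indicator g := by
  have hq' : 0 < q.toReal := ENNReal.toReal_pos hq0 hq
  rw [eLpNorm_indicator_eq_eLpNorm_restrict hA, eLpNorm_eq_lintegral_rpow_enorm_toReal hq0 hq,
    eLpNorm_eq_lintegral_rpow_enorm_toReal hq0 hq,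
    ENNReal.rpow_le_rpow_iff (by positivity), ← lintegral_add_compl _ hA] at h
  -- Finiteness allows the integral over `A` to be cancelled, leaving a zero integral over the
  -- complement.
  have hfin : ∫⁻ x in A, ‖g x‖ₑ ^ q.toReal ≠ ⊤ :=
    ((setLIntegral_le_lintegral _ _).trans_lt
      (lintegral_rpow_enorm_lt_top_of_eLpNorm_lt_top hq0 hq hg.2)).ne
  have h0 : ∫⁻ x in Aᶜ, ‖g x‖ₑ ^ q.toReal = 0 := by
    have := (ENNReal.add_le_add_iff_left hfin).1 (h.trans_eq (add_zero _).symm)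
    simpa using this
  rw [lintegral_eq_zero_iff' (hg.1.restrict.enorm.pow_const _)] at h0
  filter_upwards [(ae_restrict_iff' hA.compl).1 h0] with x hx
  by_cases hxA : x ∈ A
  · simp [hxA]
  · have := hx hxA
    simp only [Pi.zero_apply, ENNReal.rpow_eq_zero_iff, hq', enorm_eq_zero] at this
    simpa [hxA, hq'.not_gt] using this

/-! ### Integrals against signed measures -/

theorem sintegral_congr {μ : SignedMeasure (Rn n)} {u v : Rn n → ℝ}
    (h : Set.EqOn u v (ssupport μ)) : sintegral μ u = sintegral μ v :=
  VectorMeasure.integral_congr_ae <|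
    Filter.mem_of_superset (Measure.support_mem_ae (μ := μ.variation)) h

theorem sintegral_eq_sub {F : Type*} [NormedAddCommGroup F] [NormedSpace ℝ F]
    {μ : SignedMeasure (Rn n)} {f : Rn n → F} (hf : Integrable f μ.variation) :
    Integrable f μ.toJordanDecomposition.posPart ∧ Integrable f μ.toJordanDecomposition.negPart ∧
    sintegral μ f = ∫ x, f x ∂μ.toJordanDecomposition.posPart
      - ∫ x, f x ∂μ.toJordanDecomposition.negPart := by
  rw [← SignedMeasure.totalVariation_eq_variation, SignedMeasure.totalVariation,
    integrable_add_measure] at hf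
  refine ⟨hf.1, hf.2, ?_⟩
  rw [sintegral]
  conv_lhs => rw [← SignedMeasure.toSignedMeasure_toJordanDecomposition μ]
  rw [JordanDecomposition.toSignedMeasure, VectorMeasure.integral_sub_vectorMeasure,
    VectorMeasure.integral_toSignedMeasure, VectorMeasure.integral_toSignedMeasure]
  · simpa [VectorMeasure.Integrable] using hf.1
  · simpa [VectorMeasure.Integrable] using hf.2

/-- Continuous linear maps commute with integration against signed measures. -/
theorem sintegral_clm_apply {μ : SignedMeasure (Rn n)}
    (hf : Integrable (fun x : Rn n => x) μ.variation) (L : Rn n →L[ℝ] ℝ) :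
    sintegral μ (fun x => L x) = L (sintegral μ (fun x => x)) := by
  obtain ⟨h1, h2, h3⟩ := sintegral_eq_sub hf
  rw [h3, (sintegral_eq_sub (L.integrable_comp hf)).2.2, map_sub, L.integral_comp_comm h1,
    L.integral_comp_comm h2]

/-- The integral of a non-integrable function is zero by convention, so a nonzero first moment
already forces integrability. -/
theorem IsAdmissible.integrable_id {ρ : SignedMeasure (Rn n)} (hρ : IsAdmissible ρ) :
    Integrable (fun x : Rn n => x) ρ.variation :=
  VectorMeasure.Integrable.of_integral_ne_zero hρ.moment_ne_zero

section Similarity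

variable {S : Rn n → Rn n}

theorem continuous_of_mem_similarities (hS : S ∈ similarities n) : Continuous S := by
  obtain ⟨l, -, O, z, h⟩ := hS
  rw [funext h]
  fun_prop

theorem exists_measurable_leftInverse (hS : S ∈ similarities n) :
    ∃ T : Rn n → Rn n, Measurable T ∧ LeftInverse T S := by
  obtain ⟨l, hl, O, z, h⟩ := hS
  refine ⟨fun y => O.symm (l⁻¹ • (y - z)), by fun_prop, fun y => ?_⟩
  simp [h, hl.ne']

/-- The variation of the pushforward is at most the pushforward of the variation, which is carried
by the compact image of the support. -/
theorem isCompact_ssupport_map {ρ : SignedMeasure (Rn n)} (hρ : IsCompact (ssupport ρ))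
    (hS : S ∈ similarities n) : IsCompact (ssupport (ρ.map S)) := by
  have hSc := continuous_of_mem_similarities hS
  have hK : IsCompact (S '' ssupport ρ) := hρ.image hSc
  refine hK.of_isClosed_subset Measure.isClosed_support
    (Measure.support_subset_of_isClosed hK.isClosed ?_)
  rw [mem_ae_iff]
  refine le_antisymm ((VectorMeasure.variation_map_le _).trans ?_) zero_le
  rw [Measure.map_apply hSc.measurable hK.measurableSet.compl]
  have hsub : S ⁻¹' (S '' ssupport ρ)ᶜ ⊆ (ssupport ρ)ᶜ := by
    rw [Set.preimage_compl, Set.compl_subset_compl]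
    exact Set.subset_preimage_image _ _
  exact (measure_mono hsub).trans_eq
    (Measure.measure_compl_support (μ := ρ.variation))

/-- A measurable left inverse of `S` recovers `ρ` from its pushforward, so the pushforward cannot
vanish. -/
theorem nonempty_ssupport_map {ρ : SignedMeasure (Rn n)} (hρ : ρ ≠ 0)
    (hS : S ∈ similarities n) : (ssupport (ρ.map S)).Nonempty := by
  obtain ⟨T, hT, hTS⟩ := exists_measurable_leftInverse hS
  refine Measure.nonempty_support fun h0 => hρ ?_
  rw [VectorMeasure.variation_eq_zero] at h0
  ext E hE
  have h1 := VectorMeasure.map_apply ρ (continuous_of_mem_similarities hS).measurable (hT hE)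
  rw [← Set.preimage_comp, hTS.comp_eq_id, Set.preimage_id, h0] at h1
  simpa using h1.symm

end Similarity

theorem IsAdmissible.ne_zero {ρ : SignedMeasure (Rn n)} (hρ : IsAdmissible ρ) : ρ ≠ 0 := by
  rintro rfl
  exact hρ.moment_ne_zero (VectorMeasure.integral_zero_vectorMeasure)

/-! ### The sharp constant -/

/-- The infimum is itself an admissible constant, since every admissible one dominates the ratio at
`v`. When the gradient norm is zero the ratio is unavailable, and any admissible constant gives a
zero seminorm. -/
theorem rhoSeminorm_le_sharpConst_mul {p : ℝ} {ρ : SignedMeasure (Rn n)} {v : Rn n → ℝ}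
    (hv : MemD p v) (hC : sharpConst p ρ ≠ ⊤) :
    rhoSeminorm p ρ v ≤ sharpConst p ρ * gradNorm p v := by
  have hN : gradNorm p v ≠ ⊤ := hv.2.2.2.ne
  rcases eq_or_ne (gradNorm p v) 0 with h0 | h0
  · obtain ⟨C, hCmem⟩ : {C : ℝ≥0∞ | ∀ u : Rn n → ℝ, MemD p u →
        rhoSeminorm p ρ u ≤ C * gradNorm p u}.Nonempty := by
      by_contra hne
      rw [Set.not_nonempty_iff_eq_empty] at hne
      exact hC (by rw [sharpConst, hne, sInf_empty])
    simpa [h0] using hCmem v hv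
  · rw [← ENNReal.div_le_iff h0 hN]
    exact le_sInf fun C hCmem => ENNReal.div_le_of_le_mul (hCmem v hv)

theorem ofReal_quotient_le_rhoSeminorm (p : ℝ) (ρ : SignedMeasure (Rn n)) {S : Rn n → Rn n}
    (hS : S ∈ similarities n) (v : Rn n → ℝ) :
    ENNReal.ofReal (quotient p (ρ.map S) v) ≤ rhoSeminorm p ρ v :=
  le_iSup₂ (f := fun S (_ : S ∈ similarities n) => ENNReal.ofReal (quotient p (ρ.map S) v)) S hS

/-- Needed to cancel `C_*`. The test function is `x ↦ ⟨a, x⟩`, with `a` the first moment, cut off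
away from the support; its integral is `‖a‖ ^ 2 > 0`. -/
theorem sharpConst_ne_zero (p : ℝ) {ρ : SignedMeasure (Rn n)} (hρ : IsAdmissible ρ) :
    sharpConst p ρ ≠ 0 := by
  intro h0
  set a : Rn n := sintegral ρ (fun y => y) with ha
  obtain ⟨R, hR⟩ := hρ.isCompact_support.isBounded.subset_closedBall 0
  let χ : ContDiffBump (0 : Rn n) := ⟨max R 1, max R 1 + 1, by positivity, by linarith⟩
  set w : Rn n → ℝ := fun x => χ x * innerSL ℝ a x with hw
  have hwD : MemD p w := memD_of_contDiff (χ.contDiff.mul (innerSL ℝ a).contDiff)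
    χ.hasCompactSupport.mul_right p
  have hint : sintegral ρ w = ‖a‖ ^ 2 := by
    have : Set.EqOn w (fun x => innerSL ℝ a x) (ssupport ρ) := fun x hx => by
      have : x ∈ Metric.closedBall (0 : Rn n) χ.rIn :=
        Metric.closedBall_subset_closedBall (le_max_left _ _) (hR hx)
      simp [hw, χ.one_of_mem_closedBall this]
    rw [sintegral_congr this, sintegral_clm_apply hρ.integrable_id, ← ha]
    simp
  have hid : (fun y : Rn n => y) ∈ similarities n :=
    ⟨1, one_pos, LinearIsometryEquiv.refl ℝ _, 0, fun y => by simp⟩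
  have h1 := (ofReal_quotient_le_rhoSeminorm p ρ hid w).trans
    (rhoSeminorm_le_sharpConst_mul hwD (by simp [h0]))
  rw [h0, zero_mul, nonpos_iff_eq_zero, ENNReal.ofReal_eq_zero] at h1
  have hmap : ρ.map (fun y => y) = ρ := VectorMeasure.map_id ρ
  rw [hmap, quotient, hint, ← ha] at h1
  have ha0 : 0 < ‖a‖ := norm_pos_iff.2 hρ.moment_ne_zero
  exact h1.not_gt (by positivity)

/-- An extremal is not changed by a truncation that preserves it on the support of the measure. -/
theorem IsExtremal.eq_of_hasWeakGradient_indicator {p : ℝ} (hp : 0 < p)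
    {ρ : SignedMeasure (Rn n)} (hρ : IsAdmissible ρ) {S : Rn n → Rn n} (hS : S ∈ similarities n)
    {u : Rn n → ℝ} (hu : IsExtremal p ρ u)
    (hattain : rhoSeminorm p ρ u = ENNReal.ofReal (quotient p (ρ.map S) u))
    {v : Rn n → ℝ} {A : Set (Rn n)} (hA : MeasurableSet A) (hv : Continuous v)
    (hvg : HasWeakGradient v (A.indicator (weakGradient u)))
    (huv : Set.EqOn u v (ssupport (ρ.map S))) : u = v := by
  obtain ⟨⟨huc, hug, hup⟩, hext⟩ := hu
  have hq0 : ENNReal.ofReal p ≠ 0 := by simpa using hp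
  have hgrad : weakGradient u =ᵐ[volume] A.indicator (weakGradient u) := by
    refine indicator_ae_eq_of_eLpNorm_le hq0 ENNReal.ofReal_ne_top hA hup ?_
    rw [← hvg.gradNorm_eq]
    change gradNorm p u ≤ _
    have hvD : MemD p v := hvg.memD hv (hup.indicator hA)
    -- An infinite constant is harmless: the attained quotient is finite, so extremality would force
    -- `‖Du‖ = 0`.
    by_cases hC : sharpConst p ρ = ⊤
    · have h0 : gradNorm p u = 0 := by
        by_contra h0
        rw [hC, ENNReal.top_mul h0, hattain] at hext
        exact ENNReal.ofReal_ne_top hext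
      simp [h0]
    · rw [← ENNReal.mul_le_mul_iff_right (sharpConst_ne_zero p hρ) hC, ← hext, hattain]
      have hquot : quotient p (ρ.map S) u = quotient p (ρ.map S) v := by
        rw [quotient, quotient, sintegral_congr huv]
      rw [hquot]
      exact (ofReal_quotient_le_rhoSeminorm p ρ hS v).trans (rhoSeminorm_le_sharpConst_mul hvD hC)
  -- A point of the support, where `u = v`, fixes the constant `u - v` as zero.
  obtain ⟨y, hy⟩ := nonempty_ssupport_map hρ.ne_zero hS
  ext x
  have := (hasWeakGradient_weakGradient hug).sub_eq hvg huc hv hgrad x y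
  rw [huv hy, sub_self] at this
  linarith

end MorreyExtremal

/-! ### Conclusion: truncation at the extreme values on the support. -/

theorem mainTheorem6 (n : ℕ) (p : ℝ) (hp : (n : ℝ) < p)
    (ρ : MeasureTheory.SignedMeasure (MorreyExtremal.Rn n)) (hρ : MorreyExtremal.IsAdmissible ρ)
    (S : MorreyExtremal.Rn n → MorreyExtremal.Rn n) (hS : S ∈ MorreyExtremal.similarities n)
    (u : MorreyExtremal.Rn n → ℝ) (hu : MorreyExtremal.IsExtremal p ρ u)
    (hattain : MorreyExtremal.rhoSeminorm p ρ u =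
      ENNReal.ofReal (MorreyExtremal.quotient p (ρ.map S) u)) :
    (∃ m : ℝ, IsLeast (u '' MorreyExtremal.ssupport (ρ.map S)) m ∧ IsGLB (Set.range u) m) ∧
    (∃ M : ℝ, IsGreatest (u '' MorreyExtremal.ssupport (ρ.map S)) M ∧
      IsLUB (Set.range u) M) := by
  have hp0 : 0 < p := (Nat.cast_nonneg n).trans_lt hp
  have huc : Continuous u := hu.1.1
  have hgrad := MorreyExtremal.hasWeakGradient_weakGradient hu.1.2.1
  have hK := (MorreyExtremal.isCompact_ssupport_map hρ.isCompact_support hS).image huc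
  have hne := (MorreyExtremal.nonempty_ssupport_map hρ.ne_zero hS).image u
  obtain ⟨m, hm⟩ := hK.exists_isLeast hne
  obtain ⟨M, hM⟩ := hK.exists_isGreatest hne
  refine ⟨⟨m, hm, ?_, fun b hb => hb (Set.image_subset_range _ _ hm.1)⟩,
    ⟨M, hM, ?_, fun b hb => hb (Set.image_subset_range _ _ hM.1)⟩⟩
  · have h := hu.eq_of_hasWeakGradient_indicator hp0 hρ hS hattain
      (isOpen_lt continuous_const huc).measurableSet (huc.max continuous_const)
      (hgrad.max_const huc m) fun x hx => (max_eq_left (hm.2 ⟨x, hx, rfl⟩)).symm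
    rintro _ ⟨x, rfl⟩
    rw [h]
    exact le_max_right _ _
  · have h := hu.eq_of_hasWeakGradient_indicator hp0 hρ hS hattain
      (isOpen_lt huc continuous_const).measurableSet (huc.min continuous_const)
      (hgrad.min_const huc M) fun x hx => (min_eq_left (hM.2 ⟨x, hx, rfl⟩)).symm
    rintro _ ⟨x, rfl⟩
    rw [h]
    exact min_le_right _ _
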